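/- Let $\mathcal H=\{\tfrac12(a+bi+cj+dk) : a,b,c,d\in\mathbb Z,\ a\equiv b\equiv c\equiv d \pmod 2\}$ be the ring of Hurwitz quaternions, with norm $\operatorname{N}(x)=x\bar x$ and trace $\operatorname{Tr}(x)=x+\bar x$. A Hurwitz prime above a rational prime $\ell$ is an irreducible element of $\mathcal H$ of norm $\ell$. Let $p$ be an odd prime, let $q\neq p$ be a prime, and let $\xi\in\mathcal H$ be a Hurwitz prime above $q$ that is not congruent to a rational integer modulo $p\mathcal H$. Let $\Pi_p$ be the (finite) set of classes of Hurwitz primes above $p$ up to left multiplication by units, and let $\tau_{\xi,p}$ be the metacommutation map, i.e. the permutation of $\Pi_p$ that sends the class of $\pi$ to the class of the prime $\pi'$ above $p$ for which $\pi\xi=\xi'\pi'$ with some Hurwitz prime $\xi'$ above $q$. Call a cycle of $\tau_{\xi,p}$ non-trivial if its length is greater than one. Then: 1. all non-trivial cycles of $\tau_{\xi,p}$ have length $2$ if and only if $\xi$ is pure modulo $p$, i.e. $\xi$ is congruent modulo $p\mathcal H$ to an element of $\mathcal H$ with zero real part; 2. all non-trivial cycles of $\tau_{\xi,p}$ have length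 $3$ if and only if $\operatorname{N}(\xi)\equiv\operatorname{Tr}(\xi)^2 \pmod p$. -/

import Mathlib

/-- The ring of Hurwitz quaternions, `(a + b i + c j + d k) / 2` with integers
`a ≡ b ≡ c ≡ d (mod 2)`, as a subring of the real quaternions. -/
def hurwitzRing : Subring (Quaternion ℝ) where
  carrier := {x | ∃ a b c d : ℤ, a ≡ b [ZMOD 2] ∧ b ≡ c [ZMOD 2] ∧ c ≡ d [ZMOD 2] ∧
    x.re = a / 2 ∧ x.imI = b / 2 ∧ x.imJ = c / 2 ∧ x.imK = d / 2}
  mul_mem' := by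
    rintro p q ⟨a, b, c, d, h1, h2, h3, e1, e2, e3, e4⟩
      ⟨a', b', c', d', h1', h2', h3', e1', e2', e3', e4'⟩
    obtain ⟨z, hz⟩ := h3.symm.dvd
    obtain ⟨y, hy⟩ := (h2.trans h3).symm.dvd
    obtain ⟨x, hx⟩ := (h1.trans (h2.trans h3)).symm.dvd
    obtain ⟨z', hz'⟩ := h3'.symm.dvd
    obtain ⟨y', hy'⟩ := (h2'.trans h3').symm.dvd
    obtain ⟨x', hx'⟩ := (h1'.trans (h2'.trans h3')).symm.dvd
    obtain rfl : a = d + 2 * x := by linarith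
    obtain rfl : b = d + 2 * y := by linarith
    obtain rfl : c = d + 2 * z := by linarith
    obtain rfl : a' = d' + 2 * x' := by linarith
    obtain rfl : b' = d' + 2 * y' := by linarith
    obtain rfl : c' = d' + 2 * z' := by linarith
    refine ⟨-(d * d') + d * (x' - y' - z') + d' * (x - y - z) + 2 * (x * x' - y * y' - z * z'),
      d * d' + d * (x' + y' - z') + d' * (x + y + z) + 2 * (x * y' + y * x'),
      d * d' + d * (x' + y' + z') + d' * (x - y + z) + 2 * (x * z' + z * x'),
      d * d' + d * (x' - y' + z') + d' * (x + y - z) + 2 * (x * 0 + y * z' - z * y'),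
      ?_, ?_, ?_, ?_, ?_, ?_, ?_⟩
    · exact Int.modEq_iff_dvd.2 ⟨d * d' + d * y' + d' * (y + z) + (x * y' + y * x')
        - (x * x' - y * y' - z * z'), by ring⟩
    · exact Int.modEq_iff_dvd.2 ⟨d * z' - d' * y + (x * z' + z * x') - (x * y' + y * x'),
        by ring⟩
    · exact Int.modEq_iff_dvd.2 ⟨-(d * y') + d' * (y - z) + (y * z' - z * y')
        - (x * z' + z * x'), by ring⟩
    · rw [Quaternion.re_mul, e1, e2, e3, e4, e1', e2', e3', e4']
      push_cast
      ring
    · rw [Quaternion.imI_mul, e1, e2, e3, e4, e1', e2', e3', e4']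
      push_cast
      ring
    · rw [Quaternion.imJ_mul, e1, e2, e3, e4, e1', e2', e3', e4']
      push_cast
      ring
    · rw [Quaternion.imK_mul, e1, e2, e3, e4, e1', e2', e3', e4']
      push_cast
      ring
  one_mem' := ⟨2, 0, 0, 0, by decide, by decide, by decide,
    by simp [Quaternion.re_one], by simp [Quaternion.imI_one], by simp [Quaternion.imJ_one],
    by simp [Quaternion.imK_one]⟩
  add_mem' := by
    rintro p q ⟨a, b, c, d, h1, h2, h3, e1, e2, e3, e4⟩
      ⟨a', b', c', d', h1', h2', h3', e1', e2', e3', e4'⟩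
    exact ⟨a + a', b + b', c + c', d + d', h1.add h1', h2.add h2', h3.add h3',
      by simp [e1, e1', add_div], by simp [e2, e2', add_div], by simp [e3, e3', add_div],
      by simp [e4, e4', add_div]⟩
  zero_mem' := ⟨0, 0, 0, 0, by decide, by decide, by decide,
    by simp [Quaternion.re_zero], by simp [Quaternion.imI_zero], by simp [Quaternion.imJ_zero],
    by simp [Quaternion.imK_zero]⟩
  neg_mem' := by
    rintro p ⟨a, b, c, d, h1, h2, h3, e1, e2, e3, e4⟩
    exact ⟨-a, -b, -c, -d, h1.neg, h2.neg, h3.neg,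
      by simp [e1, neg_div], by simp [e2, neg_div], by simp [e3, neg_div], by simp [e4, neg_div]⟩

/-- Hurwitz quaternions. -/
abbrev Hurwitz : Type := hurwitzRing

namespace Hurwitz

theorem exists_normSq_eq (x : Hurwitz) :
    ∃ n : ℤ, (n : ℝ) = Quaternion.normSq (x : Quaternion ℝ) := by
  obtain ⟨u, a, b, c, d, h1, h2, h3, e1, e2, e3, e4⟩ := x
  obtain ⟨z, hz⟩ := h3.symm.dvd
  obtain ⟨y, hy⟩ := (h2.trans h3).symm.dvd
  obtain ⟨x, hx⟩ := (h1.trans (h2.trans h3)).symm.dvd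
  obtain rfl : a = d + 2 * x := by linarith
  obtain rfl : b = d + 2 * y := by linarith
  obtain rfl : c = d + 2 * z := by linarith
  refine ⟨d * d + d * (x + y + z) + x * x + y * y + z * z, ?_⟩
  have h := Quaternion.normSq_def' (a := u)
  rw [e1, e2, e3, e4] at h
  rw [h]
  push_cast
  ring

theorem exists_trace_eq (x : Hurwitz) :
    ∃ n : ℤ, (n : ℝ) = 2 * (x : Quaternion ℝ).re := by
  obtain ⟨u, a, b, c, d, h1, h2, h3, e1, e2, e3, e4⟩ := x
  exact ⟨a, by rw [e1]; ring⟩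

/-- The norm `N(x) = x x̄` of a Hurwitz quaternion, which is an integer. -/
noncomputable def norm (x : Hurwitz) : ℤ := ⌊Quaternion.normSq (x : Quaternion ℝ)⌋

/-- The trace `Tr(x) = x + x̄ = 2 Re(x)` of a Hurwitz quaternion, which is an integer. -/
noncomputable def trace (x : Hurwitz) : ℤ := ⌊2 * (x : Quaternion ℝ).re⌋

theorem norm_cast_eq (x : Hurwitz) : (norm x : ℝ) = Quaternion.normSq (x : Quaternion ℝ) := by
  obtain ⟨n, hn⟩ := exists_normSq_eq x
  rw [norm, ← hn, Int.floor_intCast]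

theorem trace_cast_eq (x : Hurwitz) : (trace x : ℝ) = 2 * (x : Quaternion ℝ).re := by
  obtain ⟨n, hn⟩ := exists_trace_eq x
  rw [trace, ← hn, Int.floor_intCast]

theorem norm_mul (x y : Hurwitz) : norm (x * y) = norm x * norm y := by
  have h : (norm (x * y) : ℝ) = ((norm x * norm y : ℤ) : ℝ) := by
    rw [Int.cast_mul, norm_cast_eq, norm_cast_eq, norm_cast_eq, Subring.coe_mul, map_mul]
  exact_mod_cast h

theorem norm_one : norm 1 = 1 := by simp [norm]

theorem norm_nonneg (x : Hurwitz) : 0 ≤ norm x := by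
  have h : (0 : ℝ) ≤ norm x := by rw [norm_cast_eq]; exact Quaternion.normSq_nonneg
  exact_mod_cast h

theorem norm_eq_zero {x : Hurwitz} : norm x = 0 ↔ x = 0 := by
  have h := norm_cast_eq x
  constructor
  · intro h0
    rw [h0, Int.cast_zero] at h
    exact Subtype.ext (Quaternion.normSq_eq_zero.1 h.symm)
  · rintro rfl
    simp [norm]

theorem norm_natCast (n : ℕ) : norm (n : Hurwitz) = (n : ℤ) ^ 2 := by
  have h : (norm (n : Hurwitz) : ℝ) = (((n : ℤ) ^ 2 : ℤ) : ℝ) := by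
    rw [norm_cast_eq]
    rw [Int.cast_pow, Int.cast_natCast]
    exact Quaternion.normSq_natCast (R := ℝ) n
  exact_mod_cast h

/-- The conjugate of a Hurwitz quaternion. -/
noncomputable def conj (x : Hurwitz) : Hurwitz :=
  ⟨star (x : Quaternion ℝ), by
    obtain ⟨u, a, b, c, d, h1, h2, h3, e1, e2, e3, e4⟩ := x
    refine ⟨a, -b, -c, -d, ?_, h2.neg, h3.neg, by simp [e1], by simp [e2, neg_div],
      by simp [e3, neg_div], by simp [e4, neg_div]⟩
    exact h1.trans (Int.modEq_iff_dvd.2 ⟨-b, by ring⟩)⟩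

theorem mul_conj (x : Hurwitz) : x * conj x = (norm x : Hurwitz) := by
  apply Subtype.ext
  have := Quaternion.self_mul_star (x : Quaternion ℝ)
  rw [← norm_cast_eq, Quaternion.coe_intCast] at this
  simpa [conj] using this

theorem conj_mul (x : Hurwitz) : conj x * x = (norm x : Hurwitz) := by
  apply Subtype.ext
  have := Quaternion.star_mul_self (x : Quaternion ℝ)
  rw [← norm_cast_eq, Quaternion.coe_intCast] at this
  simpa [conj] using this

theorem norm_conj (x : Hurwitz) : norm (conj x) = norm x := by
  simp [norm, conj]

theorem conj_conj (x : Hurwitz) : conj (conj x) = x := by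
  apply Subtype.ext
  simp [conj]

theorem conj_mul_rev (x y : Hurwitz) : conj (x * y) = conj y * conj x := by
  apply Subtype.ext
  simp [conj]

theorem conj_add (x y : Hurwitz) : conj (x + y) = conj x + conj y := by
  apply Subtype.ext
  simp [conj]

theorem conj_one : conj 1 = 1 := by
  apply Subtype.ext
  simp [conj]

theorem isUnit_iff {x : Hurwitz} : IsUnit x ↔ norm x = 1 := by
  constructor
  · rintro ⟨u, rfl⟩
    have h : norm (u : Hurwitz) * norm ((u⁻¹ : Hurwitzˣ) : Hurwitz) = 1 := by
      rw [← norm_mul, Units.mul_inv, norm_one]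
    exact Int.eq_one_of_mul_eq_one_right (norm_nonneg _) h
  · intro h
    exact ⟨⟨x, conj x, by rw [mul_conj, h, Int.cast_one], by rw [conj_mul, h, Int.cast_one]⟩, rfl⟩

theorem irreducible_of_norm {p : ℕ} (hp : p.Prime) {x : Hurwitz} (h : norm x = p) :
    Irreducible x := by
  refine ⟨?_, ?_⟩
  · rw [isUnit_iff, h]
    exact_mod_cast hp.ne_one
  · rintro a b rfl
    rw [norm_mul] at h
    have h' : (norm a).natAbs * (norm b).natAbs = p := by
      rw [← Int.natAbs_mul, h, Int.natAbs_natCast]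
    have ha := norm_nonneg a
    have hb := norm_nonneg b
    rw [isUnit_iff, isUnit_iff]
    rcases Nat.prime_mul_iff.1 (h' ▸ hp) with ⟨_, h1⟩ | ⟨_, h1⟩ <;> omega

/-- `π` is a Hurwitz prime (an irreducible element) above `p`, that is, of norm `p`. -/
def IsPrimeAbove (p : ℕ) (π : Hurwitz) : Prop := Irreducible π ∧ norm π = p

/-- Left associated primes above `p`: `π` and `u π` with `u` a unit. -/
def leftAssociated (p : ℕ) : Setoid {π : Hurwitz // IsPrimeAbove p π} where
  r π π' := ∃ u : Hurwitzˣ, (π' : Hurwitz) = u * π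
  iseqv :=
    { refl := fun π => ⟨1, by simp⟩
      symm := by
        rintro _ _ ⟨u, h⟩
        exact ⟨u⁻¹, by rw [h, Units.inv_mul_cancel_left]⟩
      trans := by
        rintro _ _ _ ⟨u, h⟩ ⟨v, h'⟩
        exact ⟨v * u, by rw [h', h, Units.val_mul, mul_assoc]⟩ }

/-- The set `Π_p` of classes of left associated Hurwitz primes above `p`. -/
abbrev PrimeClass (p : ℕ) : Type := Quotient (leftAssociated p)

/-- The class of a prime above `p`. -/
def PrimeClass.mk {p : ℕ} (π : Hurwitz) (h : IsPrimeAbove p π) : PrimeClass p :=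
  Quotient.mk (leftAssociated p) ⟨π, h⟩

theorem finite_norm_eq (n : ℤ) : {x : Hurwitz | norm x = n}.Finite := by
  let s : Set (ℤ × ℤ × ℤ × ℤ) := Set.Icc (-(4 * n)) (4 * n) ×ˢ Set.Icc (-(4 * n)) (4 * n) ×ˢ
    Set.Icc (-(4 * n)) (4 * n) ×ˢ Set.Icc (-(4 * n)) (4 * n)
  have hs : s.Finite := (Set.finite_Icc _ _).prod ((Set.finite_Icc _ _).prod
    ((Set.finite_Icc _ _).prod (Set.finite_Icc _ _)))
  have ht := hs.image (fun t : ℤ × ℤ × ℤ × ℤ =>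
    (⟨(t.1 : ℝ) / 2, (t.2.1 : ℝ) / 2, (t.2.2.1 : ℝ) / 2, (t.2.2.2 : ℝ) / 2⟩ : Quaternion ℝ))
  refine Set.Finite.of_finite_image (ht.subset ?_) (Subtype.val_injective.injOn)
  rintro _ ⟨⟨u, a, b, c, d, h1, h2, h3, e1, e2, e3, e4⟩, hx, rfl⟩
  refine ⟨(a, b, c, d), ?_, QuaternionAlgebra.ext e1.symm e2.symm e3.symm e4.symm⟩
  have h : a * a + b * b + c * c + d * d = 4 * n := by
    have := norm_cast_eq ⟨u, a, b, c, d, h1, h2, h3, e1, e2, e3, e4⟩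
    rw [show norm _ = n from hx] at this
    have hu := Quaternion.normSq_def' (a := u)
    rw [e1, e2, e3, e4] at hu
    rw [hu] at this
    have h' : ((a * a + b * b + c * c + d * d : ℤ) : ℝ) = ((4 * n : ℤ) : ℝ) := by
      push_cast
      rw [this]
      ring
    exact_mod_cast h'
  have key : ∀ e : ℤ, e ≤ e * e ∧ -e ≤ e * e := fun e => by
    constructor <;> rcases le_or_gt e 0 with h | h <;> nlinarith
  have := key a
  have := key b
  have := key c
  have := key d
  have := mul_self_nonneg a
  have := mul_self_nonneg b
  have := mul_self_nonneg c
  have := mul_self_nonneg d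
  simp only [s, Set.mem_prod, Set.mem_Icc]
  refine ⟨⟨?_, ?_⟩, ⟨?_, ?_⟩, ⟨?_, ?_⟩, ⟨?_, ?_⟩⟩ <;> linarith

instance (p : ℕ) : Finite (PrimeClass p) := by
  have : Finite {π : Hurwitz // IsPrimeAbove p π} :=
    ((finite_norm_eq (p : ℤ)).subset (fun _ h => h.2)).to_subtype
  exact Quotient.finite _

noncomputable instance (p : ℕ) : Fintype (PrimeClass p) := Fintype.ofFinite _

noncomputable instance (p : ℕ) : DecidableEq (PrimeClass p) := Classical.decEq _

/-- Every real quaternion is at distance less than one from a Hurwitz quaternion. -/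
theorem exists_near (x : Quaternion ℝ) :
    ∃ y : Hurwitz, Quaternion.normSq (x - (y : Quaternion ℝ)) < 1 := by
  have key : ∀ t : ℝ, (t - round t) ^ 2 ≤ 1 / 4 ∧
      ((t - round t) ^ 2 = 1 / 4 → ∃ n : ℤ, t = (2 * n + 1 : ℤ) / 2) := by
    intro t
    have h := abs_le.1 (abs_sub_round t)
    refine ⟨by nlinarith, fun h' => ?_⟩
    have h2 : (t - round t - 1 / 2) * (t - round t + 1 / 2) = 0 := by linarith
    rcases mul_eq_zero.1 h2 with h3 | h3
    · exact ⟨round t, by push_cast; linarith⟩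
    · exact ⟨round t - 1, by push_cast; linarith⟩
  obtain ⟨a1, a2⟩ := key x.re
  obtain ⟨b1, b2⟩ := key x.imI
  obtain ⟨c1, c2⟩ := key x.imJ
  obtain ⟨d1, d2⟩ := key x.imK
  by_cases hlt : (x.re - round x.re) ^ 2 + (x.imI - round x.imI) ^ 2 +
      (x.imJ - round x.imJ) ^ 2 + (x.imK - round x.imK) ^ 2 < 1
  · refine ⟨⟨⟨round x.re, round x.imI, round x.imJ, round x.imK⟩, 2 * round x.re,
      2 * round x.imI, 2 * round x.imJ, 2 * round x.imK, ?_, ?_, ?_,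
      by simp, by simp, by simp, by simp⟩, ?_⟩
    · exact Int.modEq_iff_dvd.2 ⟨round x.imI - round x.re, by ring⟩
    · exact Int.modEq_iff_dvd.2 ⟨round x.imJ - round x.imI, by ring⟩
    · exact Int.modEq_iff_dvd.2 ⟨round x.imK - round x.imJ, by ring⟩
    · rw [Quaternion.normSq_def', Quaternion.re_sub, Quaternion.imI_sub, Quaternion.imJ_sub,
        Quaternion.imK_sub]
      exact hlt
  · obtain ⟨a, ha⟩ := a2 (by linarith)
    obtain ⟨b, hb⟩ := b2 (by linarith)
    obtain ⟨c, hc⟩ := c2 (by linarith)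
    obtain ⟨d, hd⟩ := d2 (by linarith)
    refine ⟨⟨x, 2 * a + 1, 2 * b + 1, 2 * c + 1, 2 * d + 1, ?_, ?_, ?_,
      ha, hb, hc, hd⟩, by simp⟩
    · exact Int.modEq_iff_dvd.2 ⟨b - a, by ring⟩
    · exact Int.modEq_iff_dvd.2 ⟨c - b, by ring⟩
    · exact Int.modEq_iff_dvd.2 ⟨d - c, by ring⟩

theorem exists_norm_sub_lt (a : Hurwitz) {b : Hurwitz} (hb : b ≠ 0) :
    ∃ c : Hurwitz, norm (a - c * b) < norm b := by
  have hb' : (b : Quaternion ℝ) ≠ 0 := fun h => hb (Subtype.ext h)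
  obtain ⟨c, hc⟩ := exists_near ((a : Quaternion ℝ) * (b : Quaternion ℝ)⁻¹)
  refine ⟨c, ?_⟩
  have h : ((a - c * b : Hurwitz) : Quaternion ℝ) =
      ((a : Quaternion ℝ) * (b : Quaternion ℝ)⁻¹ - c) * b := by
    rw [sub_mul, inv_mul_cancel_right₀ hb']
    rfl
  have hpos : 0 < Quaternion.normSq (b : Quaternion ℝ) :=
    lt_of_le_of_ne Quaternion.normSq_nonneg (Ne.symm (Quaternion.normSq_ne_zero.2 hb'))
  have h2 : (norm (a - c * b) : ℝ) < norm b := by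
    rw [norm_cast_eq, norm_cast_eq, h, map_mul]
    nlinarith
  exact_mod_cast h2

theorem exists_right_gcd (b : Hurwitz) : ∀ a : Hurwitz, b ≠ 0 →
    ∃ g s t x y : Hurwitz, g = x * a + y * b ∧ a = s * g ∧ b = t * g := by
  induction hn : (norm b).toNat using Nat.strong_induction_on generalizing b with
  | _ n ih =>
    intro a hb
    obtain ⟨c, hc⟩ := exists_norm_sub_lt a hb
    by_cases hr : a - c * b = 0
    · exact ⟨b, c, 1, 0, 1, by simp, by rw [sub_eq_zero] at hr; exact hr, by simp⟩
    · have h0 := norm_nonneg (a - c * b)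
      obtain ⟨g, s, t, x, y, h1, h2, h3⟩ := ih _ (by omega) (a - c * b) rfl b hr
      refine ⟨g, t + c * s, s, y, x - y * c, ?_, ?_, h2⟩
      · rw [h1]
        noncomm_ring
      · rw [add_mul, ← h3, mul_assoc, ← h2]
        noncomm_ring

theorem not_dvd_of_prime {p q : ℕ} (hp : p.Prime) (hq : q.Prime) (hpq : p ≠ q)
    {π ξ : Hurwitz} (hπ : norm π = p) (hξ : norm ξ = q) (z : Hurwitz) :
    π * ξ ≠ (p : Hurwitz) * z := by
  intro h
  have hp0 : (p : Hurwitz) ≠ 0 := by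
    rw [Ne, ← norm_eq_zero, norm_natCast]
    exact_mod_cast pow_ne_zero 2 hp.ne_zero
  have hn := congrArg norm h
  rw [norm_mul, norm_mul, norm_natCast, hπ, hξ, pow_two, mul_assoc] at hn
  have hn' := mul_left_cancel₀ (by exact_mod_cast hp.ne_zero) hn
  have : (p : ℤ) ∣ q := ⟨norm z, hn'⟩
  exact hpq ((Nat.prime_dvd_prime_iff_eq hp hq).1 (by exact_mod_cast this))

/-- Metacommutation by `ξ`: the class `c'` corresponds to `c` when `π ξ = ξ' π'` for some `π` in
`c`, some `π'` in `c'` and some prime `ξ'` above `q`. -/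
def MetacommutesTo {p : ℕ} (q : ℕ) (ξ : Hurwitz) (c c' : PrimeClass p) : Prop :=
  ∃ (π π' ξ' : Hurwitz) (h : IsPrimeAbove p π) (h' : IsPrimeAbove p π'),
    PrimeClass.mk π h = c ∧ PrimeClass.mk π' h' = c' ∧ IsPrimeAbove q ξ' ∧ π * ξ = ξ' * π'

theorem existsUnique_metacommutesTo {p q : ℕ} (hp : p.Prime) (hq : q.Prime) (hpq : p ≠ q)
    {ξ : Hurwitz} (hξ : IsPrimeAbove q ξ) (c : PrimeClass p) :
    ∃! c' : PrimeClass p, MetacommutesTo q ξ c c' := by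
  have hp0 : (p : ℤ) ≠ 0 := by exact_mod_cast hp.ne_zero
  have hpH : (p : Hurwitz) ≠ 0 := by
    rw [Ne, ← norm_eq_zero, norm_natCast]
    exact pow_ne_zero 2 hp0
  obtain ⟨⟨π, hπ⟩, rfl⟩ := Quotient.exists_rep c
  have hex : ∃ g s : Hurwitz, norm g = p ∧ π * ξ = s * g := by
    obtain ⟨g, s, t, x, y, h1, h2, h3⟩ := exists_right_gcd (p : Hurwitz) (π * ξ) hpH
    refine ⟨g, s, ?_, h2⟩
    have hn := congrArg norm h3
    rw [norm_natCast, norm_mul] at hn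
    have hg0 := norm_nonneg g
    have hdvd : (norm g).toNat ∣ p ^ 2 := by
      have h : norm g ∣ (p : ℤ) ^ 2 := ⟨norm t, by rw [hn, mul_comm]⟩
      rw [← Int.toNat_of_nonneg hg0] at h
      exact_mod_cast h
    obtain ⟨k, hk, hgk⟩ := (Nat.dvd_prime_pow hp).1 hdvd
    have hgk' : norm g = (p : ℤ) ^ k := by
      rw [← Int.toNat_of_nonneg hg0, hgk]
      push_cast
      rfl
    interval_cases k
    · exfalso
      rw [pow_zero] at hgk'
      have hmul : x * (π * ξ) = g - y * (p : Hurwitz) := by rw [h1]; noncomm_ring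
      have hN : (norm (x * (π * ξ)) : Hurwitz) =
          (norm g : Hurwitz) + (p : Hurwitz) *
            (-(g * conj y) - y * conj g + (p : Hurwitz) * (y * conj y)) := by
        have hc : conj (x * (π * ξ)) = conj g - (p : Hurwitz) * conj y := by
          rw [hmul]
          apply Subtype.ext
          simp [conj]
        rw [← mul_conj, ← mul_conj, hc, hmul]
        have e1 : ∀ z : Hurwitz, z * (p : Hurwitz) = (p : Hurwitz) * z :=
          fun z => (Nat.cast_commute p z).eq.symm
        simp only [sub_mul, mul_sub, mul_add, mul_neg]
        rw [← mul_assoc g, e1 g, e1 y]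
        simp only [mul_assoc]
        rw [← mul_assoc y, e1 y]
        simp only [mul_assoc]
        abel
      rw [norm_mul, norm_mul, hπ.2, hgk'] at hN
      set w : Hurwitz := -(g * conj y) - y * conj g + (p : Hurwitz) * (y * conj y) with hw
      have h1' : (1 : Hurwitz) = (p : Hurwitz) * (((norm x * norm ξ : ℤ) : Hurwitz) - w) := by
        have e : ((norm x * (↑p * norm ξ) : ℤ) : Hurwitz) =
            (p : Hurwitz) * ((norm x * norm ξ : ℤ) : Hurwitz) := by
          have e' : norm x * ((p : ℤ) * norm ξ) = (p : ℤ) * (norm x * norm ξ) := by ring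
          rw [e', Int.cast_mul (p : ℤ), Int.cast_natCast]
        rw [e] at hN
        rw [mul_sub, hN]
        simp
      have h2' := congrArg norm h1'
      rw [norm_one, norm_mul, norm_natCast] at h2'
      have h3' : (p : ℤ) ∣ 1 := ⟨p * norm (((norm x * norm ξ : ℤ) : Hurwitz) - w), by
        rw [h2']; ring⟩
      have h4' : p ∣ 1 := by exact_mod_cast h3'
      exact hp.one_lt.ne' (Nat.dvd_one.1 h4')
    · simpa using hgk'
    · exfalso
      have ht : norm t = 1 := by
        rw [hgk'] at hn
        exact mul_right_cancel₀ (pow_ne_zero 2 hp0) (by rw [one_mul]; exact hn.symm)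
      have hg : g = (p : Hurwitz) * conj t := by
        rw [(Nat.cast_commute p (conj t)).eq, h3, ← mul_assoc, conj_mul, ht]
        simp
      refine not_dvd_of_prime hp hq hpq hπ.2 hξ.2 (s * conj t) ?_
      rw [h2, hg, ← mul_assoc, ← (Nat.cast_commute p s).eq, mul_assoc]
  obtain ⟨g, s, hg, hs⟩ := hex
  have hsn : norm s = q := by
    have h := congrArg norm hs
    rw [norm_mul, norm_mul, hπ.2, hξ.2, hg, mul_comm] at h
    exact (mul_right_cancel₀ hp0 h).symm
  have hgP : IsPrimeAbove p g := ⟨irreducible_of_norm hp hg, hg⟩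
  refine ⟨PrimeClass.mk g hgP,
    ⟨π, g, s, hπ, hgP, rfl, rfl, ⟨irreducible_of_norm hq hsn, hsn⟩, hs⟩, ?_⟩
  rintro _ ⟨π₁, π', ξ', h, h', hcl, rfl, -, heq⟩
  obtain ⟨u, hu⟩ := Quotient.exact hcl
  have hu' : π = u * π₁ := hu
  have heq2 : π * ξ = (u * ξ') * π' := by rw [hu', mul_assoc, heq, mul_assoc]
  have hπ'0 : π' ≠ 0 := by
    rw [Ne, ← norm_eq_zero, h'.2]
    exact hp0
  obtain ⟨d, m, n, x, y, e1, e2, e3⟩ := exists_right_gcd π' g hπ'0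
  -- `d` is a common right divisor of `g` and `π'`
  have hmd := congrArg norm e2
  have hnd := congrArg norm e3
  rw [norm_mul, hg] at hmd
  rw [norm_mul, h'.2] at hnd
  have hd0 := norm_nonneg d
  have hdd : (norm d).toNat ∣ p := by
    have h : norm d ∣ (p : ℤ) := ⟨norm m, by rw [hmd, mul_comm]⟩
    rw [← Int.toNat_of_nonneg hd0] at h
    exact_mod_cast h
  rcases (Nat.dvd_prime hp).1 hdd with hd1 | hdp
  · exfalso
    have hd1' : norm d = 1 := by omega
    refine not_dvd_of_prime hp hq hpq hπ.2 hξ.2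
      ((s * conj x + u * ξ' * conj y) * d) ?_
    have key : π * ξ * conj d = (p : Hurwitz) * (s * conj x + u * ξ' * conj y) := by
      have a1 : s * g * (conj g * conj x) = (p : Hurwitz) * (s * conj x) := by
        rw [mul_assoc, ← mul_assoc g, mul_conj, hg, Int.cast_natCast, ← mul_assoc,
          ← (Nat.cast_commute p s).eq, mul_assoc]
      have a2 : u * ξ' * π' * (conj π' * conj y) = (p : Hurwitz) * (u * ξ' * conj y) := by
        rw [mul_assoc (u * ξ' : Hurwitz), ← mul_assoc π', mul_conj, h'.2, Int.cast_natCast,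
          ← mul_assoc (u * ξ' : Hurwitz), ← (Nat.cast_commute p (u * ξ' : Hurwitz)).eq, mul_assoc]
      rw [e1, conj_add, conj_mul_rev, conj_mul_rev, mul_add, mul_add, ← a1, ← a2, ← hs, ← heq2]
    rw [← mul_assoc, ← key, mul_assoc, conj_mul, hd1']
    simp
  · have hdp' : norm d = p := by omega
    have hm : norm m = 1 := mul_right_cancel₀ hp0 (by rw [hdp'] at hmd; rw [one_mul]; exact hmd.symm)
    have hn : norm n = 1 := mul_right_cancel₀ hp0 (by rw [hdp'] at hnd; rw [one_mul]; exact hnd.symm)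
    obtain ⟨v, hv⟩ := isUnit_iff.2 hm
    obtain ⟨w, hw⟩ := isUnit_iff.2 hn
    refine Quotient.sound ⟨v * w⁻¹, ?_⟩
    change g = _ * π'
    rw [e2, e3, ← hv, ← hw, Units.val_mul, mul_assoc, Units.inv_mul_cancel_left]

theorem isPrimeAbove_conj {q : ℕ} (hq : q.Prime) {ξ : Hurwitz} (hξ : IsPrimeAbove q ξ) :
    IsPrimeAbove q (conj ξ) :=
  have h : norm (conj ξ) = q := by rw [norm_conj, hξ.2]
  ⟨irreducible_of_norm hq h, h⟩

theorem MetacommutesTo.symm_conj {p q : ℕ} (hq : q.Prime) {ξ : Hurwitz} (hξ : IsPrimeAbove q ξ)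
    {c c' : PrimeClass p} (h : MetacommutesTo q ξ c c') : MetacommutesTo q (conj ξ) c' c := by
  obtain ⟨π, π', ξ', h1, h2, h3, h4, h5, h6⟩ := h
  refine ⟨π', π, conj ξ', h2, h1, h4, h3, isPrimeAbove_conj hq h5, ?_⟩
  have hq0 : (q : Hurwitz) ≠ 0 := by
    rw [Ne, ← norm_eq_zero, norm_natCast]
    exact pow_ne_zero 2 (by exact_mod_cast hq.ne_zero)
  have hd : ∀ z : Hurwitz, (q : Hurwitz) * z = 0 → z = 0 := by
    intro z hz
    have := congrArg norm hz
    rw [norm_mul, norm_eq_zero.2 rfl, mul_eq_zero] at this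
    exact norm_eq_zero.1 (this.resolve_left (fun h => hq0 (norm_eq_zero.1 h)))
  have e : (q : Hurwitz) * (π' * conj ξ) = (q : Hurwitz) * (conj ξ' * π) := by
    have a : (q : Hurwitz) * (π' * conj ξ) = conj ξ' * (ξ' * π') * conj ξ := by
      rw [← mul_assoc (conj ξ'), conj_mul, h5.2, Int.cast_natCast, mul_assoc]
    have b : conj ξ' * (π * ξ) * conj ξ = (q : Hurwitz) * (conj ξ' * π) := by
      rw [← mul_assoc, mul_assoc _ ξ, mul_conj, hξ.2, Int.cast_natCast,
        (Nat.cast_commute q (conj ξ' * π)).eq]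
    rw [a, ← h6, b]
  exact sub_eq_zero.1 (hd _ (by rw [mul_sub, e, sub_self]))

/-- The metacommutation map `τ_{ξ,p}` on `Π_p`, for a Hurwitz prime `ξ` of norm `q ≠ p`: the
permutation that sends the class of `π` to the class of the prime `π'` with `π ξ = ξ' π'`. -/
noncomputable def metacommutation {p q : ℕ} (hp : p.Prime) (hq : q.Prime) (hpq : p ≠ q)
    (ξ : Hurwitz) (hξ : IsPrimeAbove q ξ) : Equiv.Perm (PrimeClass p) where
  toFun c := (existsUnique_metacommutesTo hp hq hpq hξ c).choose
  invFun c := (existsUnique_metacommutesTo hp hq hpq (isPrimeAbove_conj hq hξ) c).choose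
  left_inv c := by
    have h := (existsUnique_metacommutesTo hp hq hpq hξ c).choose_spec.1
    exact ((existsUnique_metacommutesTo hp hq hpq (isPrimeAbove_conj hq hξ) _).choose_spec.2 _
      (h.symm_conj hq hξ)).symm
  right_inv c := by
    have h := (existsUnique_metacommutesTo hp hq hpq (isPrimeAbove_conj hq hξ) c).choose_spec.1
    have h' := h.symm_conj hq (isPrimeAbove_conj hq hξ)
    rw [conj_conj] at h'
    exact ((existsUnique_metacommutesTo hp hq hpq hξ _).choose_spec.2 _ h').symm

theorem metacommutation_eq_iff {p q : ℕ} (hp : p.Prime) (hq : q.Prime) (hpq : p ≠ q)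
    (ξ : Hurwitz) (hξ : IsPrimeAbove q ξ) (c c' : PrimeClass p) :
    metacommutation hp hq hpq ξ hξ c = c' ↔ MetacommutesTo q ξ c c' := by
  have h := (existsUnique_metacommutesTo hp hq hpq hξ c).choose_spec
  exact ⟨fun e => e ▸ h.1, fun e => (h.2 _ e).symm⟩

/-- Congruence of Hurwitz quaternions modulo `p`, that is, modulo the ideal `p 𝓗`. -/
def CongMod (p : ℕ) (x y : Hurwitz) : Prop := ∃ z : Hurwitz, x - y = (p : Hurwitz) * z

/-- `x` is pure modulo `p`: it is congruent modulo `p` to a quaternion with zero real part. -/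
def IsPureMod (p : ℕ) (x : Hurwitz) : Prop :=
  ∃ y : Hurwitz, (y : Quaternion ℝ).re = 0 ∧ CongMod p x y

end Hurwitz

/-!
The ring `𝓗 / p 𝓗` is a matrix algebra, the classes in `Π_p` are its minimal left ideals, and
`τ = τ_{ξ,p}` acts on them through right multiplication by `ξ`. The theorem rests on the fact
that `τ ^ n = 1` exactly when `ξ ^ n` is a scalar modulo `p`. Only the following elementary form
of this is needed.

* The class of `π` is fixed by `τ ^ n` iff `p` divides `π ξⁿ π̄`
  (`metacommutation_pow_apply_eq_self_iff`). The point is that `π η = s π'` together with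
  `p ∣ π η π̄` forces `p ∣ π π̄'` when `N(η)` is prime to `p`, and then `π` and `π'` are associated.
* If `p ∣ π ξ π̄` for all `π` of norm `p`, then `ξ` is congruent to an integer modulo `p`
  (`exists_int_congMod`). Indeed every `w` with `p ∣ N(w)` is divisible by `p` or by a `π` of
  norm `p`, so that `p ∣ w ξ w̄`. For pure `w` not divisible by `p` the latter says that the imaginary part
  of `ξ` is orthogonal to `w` modulo `p`. The isotropic vectors `(a, b, ±1)` with `a² + b² + 1 ≡ 0` and
  their permutations leave no room for a nonzero imaginary part.

Hence if `ξⁿ = a ξ + b` with integers `a` and `b`, then `τ ^ n = 1` iff `p ∣ a`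
(`metacommutation_pow_eq_one_iff`). With `T = Tr(ξ)` and `N = N(ξ)`, the relation `ξ² = T ξ - N`
gives `a = T` for `n = 2`, and it gives `a = T² - N` for `n = 3`. For a prime `r`, all non-trivial
cycles have length `r` iff `τ ^ r = 1`.
-/

namespace Hurwitz

/-! ### Coordinates and divisibility by a rational integer -/

theorem exists_coordinates_eq {a b c d : ℤ} (h1 : a ≡ b [ZMOD 2]) (h2 : b ≡ c [ZMOD 2])
    (h3 : c ≡ d [ZMOD 2]) :
    ∃ z : Hurwitz, (z : Quaternion ℝ).re = a / 2 ∧ (z : Quaternion ℝ).imI = b / 2 ∧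
      (z : Quaternion ℝ).imJ = c / 2 ∧ (z : Quaternion ℝ).imK = d / 2 :=
  ⟨⟨⟨a / 2, b / 2, c / 2, d / 2⟩, a, b, c, d, h1, h2, h3, rfl, rfl, rfl, rfl⟩,
    rfl, rfl, rfl, rfl⟩

theorem coe_conj (x : Hurwitz) : (conj x : Quaternion ℝ) = star (x : Quaternion ℝ) := rfl

theorem natCast_dvd_mul_left {p : ℕ} {z : Hurwitz} (h : (p : Hurwitz) ∣ z) (x : Hurwitz) :
    (p : Hurwitz) ∣ x * z := by
  obtain ⟨y, rfl⟩ := h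
  exact ⟨x * y, by rw [← mul_assoc, ← mul_assoc, (Nat.cast_commute p x).eq]⟩

theorem natCast_dvd_conj {p : ℕ} {z : Hurwitz} (h : (p : Hurwitz) ∣ z) :
    (p : Hurwitz) ∣ conj z := by
  obtain ⟨y, rfl⟩ := h
  refine ⟨conj y, ?_⟩
  rw [conj_mul_rev, (Nat.cast_commute p (conj y)).eq]
  congr 1
  apply Subtype.ext
  simp [conj]

theorem natCast_dvd_intCast {p : ℕ} {n : ℤ} (h : (p : ℤ) ∣ n) :
    (p : Hurwitz) ∣ (n : Hurwitz) := by
  obtain ⟨m, rfl⟩ := h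
  exact ⟨m, by push_cast; rfl⟩

theorem natCast_mul_left_cancel {p : ℕ} (hp : p ≠ 0) {x y : Hurwitz}
    (h : (p : Hurwitz) * x = p * y) : x = y := by
  have h1 : norm ((p : Hurwitz) * (x - y)) = 0 := by rw [mul_sub, h, sub_self, norm_eq_zero]
  rw [norm_mul, norm_natCast, mul_eq_zero] at h1
  exact sub_eq_zero.1 (norm_eq_zero.1 (h1.resolve_left (pow_ne_zero 2 (by exact_mod_cast hp))))

/-- An integer prime to `p` is invertible modulo `p 𝓗`. -/
theorem natCast_dvd_of_intCast_mul {p : ℕ} (hp : p.Prime) {n : ℤ} (hn : ¬ (p : ℤ) ∣ n)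
    {z : Hurwitz} (h : (p : Hurwitz) ∣ (n : Hurwitz) * z) : (p : Hurwitz) ∣ z := by
  obtain ⟨a, b, hab⟩ := (Nat.prime_iff_prime_int.1 hp).coprime_iff_not_dvd.2 hn
  have e : z = (a : Hurwitz) * (p * z) + (b : Hurwitz) * (n * z) := by
    rw [← mul_assoc, ← mul_assoc, ← add_mul]
    have : ((a * p + b * n : ℤ) : Hurwitz) = 1 := by rw [hab, Int.cast_one]
    push_cast at this
    rw [this, one_mul]
  rw [e]
  exact dvd_add (natCast_dvd_mul_left (dvd_mul_right _ _) _) (natCast_dvd_mul_left h _)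

/-- A quaternion whose norm is divisible by `p` is divisible by `p` or has a right divisor of
norm `p`, namely its right greatest common divisor with `p`. -/
theorem exists_norm_eq_of_dvd_norm {p : ℕ} (hp : p.Prime) {w : Hurwitz}
    (hw : (p : ℤ) ∣ norm w) :
    (p : Hurwitz) ∣ w ∨ ∃ s π : Hurwitz, norm π = p ∧ w = s * π := by
  have hp0 : (p : ℤ) ≠ 0 := by exact_mod_cast hp.ne_zero
  have hpH : (p : Hurwitz) ≠ 0 := by
    rw [Ne, ← norm_eq_zero, norm_natCast]
    exact pow_ne_zero 2 hp0
  obtain ⟨g, s, t, x, y, h1, h2, h3⟩ := exists_right_gcd (p : Hurwitz) w hpH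
  have hn := congrArg norm h3
  rw [norm_natCast, norm_mul] at hn
  have hg0 := norm_nonneg g
  have hdvd : (norm g).toNat ∣ p ^ 2 := by
    have h : norm g ∣ (p : ℤ) ^ 2 := ⟨norm t, by rw [hn, mul_comm]⟩
    rw [← Int.toNat_of_nonneg hg0] at h
    exact_mod_cast h
  obtain ⟨k, hk, hgk⟩ := (Nat.dvd_prime_pow hp).1 hdvd
  have hgk' : norm g = (p : ℤ) ^ k := by
    rw [← Int.toNat_of_nonneg hg0, hgk]
    push_cast
    rfl
  interval_cases k
  · -- If `g` is a unit, then `g w̄ = x N(w) + y p w̄` is divisible by `p`, and so is `w`.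
    left
    rw [pow_zero] at hgk'
    have hd : (p : Hurwitz) ∣ g * conj w := by
      rw [h1, add_mul, mul_assoc, mul_conj, mul_assoc]
      exact dvd_add (natCast_dvd_mul_left (natCast_dvd_intCast hw) x)
        (natCast_dvd_mul_left (dvd_mul_right _ _) y)
    have := natCast_dvd_conj (natCast_dvd_mul_left hd (conj g))
    rwa [← mul_assoc, conj_mul, hgk', Int.cast_one, one_mul, conj_conj] at this
  · exact Or.inr ⟨s, g, by simpa using hgk', h2⟩
  · left
    have ht : norm t = 1 := by
      rw [hgk'] at hn
      exact mul_right_cancel₀ (pow_ne_zero 2 hp0) (by rw [one_mul]; exact hn.symm)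
    have hg : g = conj t * (p : Hurwitz) := by
      rw [h3, ← mul_assoc, conj_mul, ht, Int.cast_one, one_mul]
    rw [h2, hg]
    exact natCast_dvd_mul_left (natCast_dvd_mul_left dvd_rfl _) _

/-! ### Fixed points of powers of the metacommutation map -/

theorem norm_pow (x : Hurwitz) (n : ℕ) : norm (x ^ n) = norm x ^ n := by
  induction n with
  | zero => simp [norm_one]
  | succ n ih => rw [pow_succ, pow_succ, norm_mul, ih]

theorem exists_mul_pow_eq {p q : ℕ} (hp : p.Prime) (hq : q.Prime) (hpq : p ≠ q) {ξ : Hurwitz}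
    (hξ : IsPrimeAbove q ξ) {π : Hurwitz} (hπ : IsPrimeAbove p π) (n : ℕ) :
    ∃ (s π' : Hurwitz) (h' : IsPrimeAbove p π'),
      (metacommutation hp hq hpq ξ hξ ^ n) (PrimeClass.mk π hπ) = PrimeClass.mk π' h' ∧
        π * ξ ^ n = s * π' := by
  induction n with
  | zero => exact ⟨1, π, hπ, by simp, by simp⟩
  | succ n ih =>
    obtain ⟨s, π₁, h₁, e, hs⟩ := ih
    obtain ⟨ρ, π₂, ξ', hρ, h₂, hc, hc', -, h⟩ :=
      (metacommutation_eq_iff hp hq hpq ξ hξ (PrimeClass.mk π₁ h₁) _).1 rfl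
    obtain ⟨u, hu⟩ := Quotient.exact hc
    have hu' : π₁ = u * ρ := hu
    refine ⟨s * (u * ξ'), π₂, h₂, ?_, ?_⟩
    · rw [pow_succ', Equiv.Perm.mul_apply, e, hc']
    · rw [pow_succ, ← mul_assoc, hs, hu', mul_assoc, mul_assoc, h]
      noncomm_ring

theorem metacommutation_pow_apply_eq_self_iff {p q : ℕ} (hp : p.Prime) (hq : q.Prime)
    (hpq : p ≠ q) {ξ : Hurwitz} (hξ : IsPrimeAbove q ξ) {π : Hurwitz} (hπ : IsPrimeAbove p π)
    (n : ℕ) :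
    (metacommutation hp hq hpq ξ hξ ^ n) (PrimeClass.mk π hπ) = PrimeClass.mk π hπ ↔
      (p : Hurwitz) ∣ π * ξ ^ n * conj π := by
  have hp0 : (p : ℤ) ≠ 0 := by exact_mod_cast hp.ne_zero
  obtain ⟨s, π', h', e, hs⟩ := exists_mul_pow_eq hp hq hpq hξ hπ n
  rw [e]
  constructor
  · intro hc
    obtain ⟨u, hu⟩ := Quotient.exact hc
    have hu' : π = u * π' := hu
    have hv : π' = (u⁻¹ : Hurwitzˣ) * π := by rw [hu', Units.inv_mul_cancel_left]
    rw [hs, hv, mul_assoc, mul_assoc, mul_conj, hπ.2, Int.cast_natCast]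
    exact natCast_dvd_mul_left (natCast_dvd_mul_left dvd_rfl _) _
  · rintro ⟨t, ht⟩
    have ht' : π * ξ ^ n = t * π := by
      apply natCast_mul_left_cancel hp.ne_zero
      rw [← mul_assoc _ t, ← ht, mul_assoc _ (conj π), conj_mul, hπ.2, Int.cast_natCast,
        (Nat.cast_commute p _).eq]
    have hnt : norm t = (q : ℤ) ^ n := by
      have h := congrArg norm ht'
      rw [norm_mul, norm_mul, norm_pow, hξ.2, hπ.2, mul_comm] at h
      exact (mul_right_cancel₀ hp0 h).symm
    have hq' : ¬ (p : ℤ) ∣ (q : ℤ) ^ n := fun h =>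
      hpq ((Nat.prime_dvd_prime_iff_eq hp hq).1
        (by exact_mod_cast (Nat.prime_iff_prime_int.1 hp).dvd_of_dvd_pow h))
    -- `t π π̄' = π ξⁿ π̄' = s π' π̄' = s p`, and `t` is invertible modulo `p`.
    have hd : (p : Hurwitz) ∣ π * conj π' := by
      apply natCast_dvd_of_intCast_mul hp hq'
      rw [← hnt, ← conj_mul, mul_assoc, ← mul_assoc t, ← ht', hs, mul_assoc s, mul_conj, h'.2,
        Int.cast_natCast]
      exact natCast_dvd_mul_left (natCast_dvd_mul_left dvd_rfl _) _
    obtain ⟨v, hv⟩ := hd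
    have hv1 : norm v = 1 := by
      have h := congrArg norm hv
      rw [norm_mul, norm_conj, hπ.2, h'.2, norm_mul, norm_natCast, ← pow_two] at h
      exact mul_left_cancel₀ (pow_ne_zero 2 hp0) (by rw [mul_one]; exact h.symm)
    obtain ⟨v, rfl⟩ := isUnit_iff.2 hv1
    refine Quotient.sound ⟨v, ?_⟩
    change π = v * π'
    apply natCast_mul_left_cancel hp.ne_zero
    rw [← mul_assoc, ← hv, mul_assoc, conj_mul, h'.2, Int.cast_natCast, (Nat.cast_commute p _).eq]

/-! ### Isotropic vectors modulo an odd prime -/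

/-- The Hurwitz quaternion `u i + v j + t k`. -/
noncomputable def pure (u v t : ℤ) : Hurwitz :=
  ⟨⟨0, u, v, t⟩, 2 * 0, 2 * u, 2 * v, 2 * t, Int.modEq_iff_dvd.2 ⟨u - 0, by ring⟩,
    Int.modEq_iff_dvd.2 ⟨v - u, by ring⟩, Int.modEq_iff_dvd.2 ⟨t - v, by ring⟩,
    by simp, by simp, by simp, by simp⟩

@[simp]
theorem re_pure (u v t : ℤ) : (pure u v t : Quaternion ℝ).re = 0 := rfl

@[simp]
theorem imI_pure (u v t : ℤ) : (pure u v t : Quaternion ℝ).imI = u := rfl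

@[simp]
theorem imJ_pure (u v t : ℤ) : (pure u v t : Quaternion ℝ).imJ = v := rfl

@[simp]
theorem imK_pure (u v t : ℤ) : (pure u v t : Quaternion ℝ).imK = t := rfl

theorem norm_pure (u v t : ℤ) : norm (pure u v t) = u ^ 2 + v ^ 2 + t ^ 2 := by
  have h : (norm (pure u v t) : ℝ) = ((u ^ 2 + v ^ 2 + t ^ 2 : ℤ) : ℝ) := by
    rw [norm_cast_eq, Quaternion.normSq_def']
    simp
  exact_mod_cast h

theorem dvd_mul_mul_conj_of_dvd_norm {p : ℕ} (hp : p.Prime) {ξ : Hurwitz}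
    (h : ∀ π : Hurwitz, norm π = p → (p : Hurwitz) ∣ π * ξ * conj π) {w : Hurwitz}
    (hw : (p : ℤ) ∣ norm w) : (p : Hurwitz) ∣ w * ξ * conj w := by
  obtain h1 | ⟨s, π, hπ, rfl⟩ := exists_norm_eq_of_dvd_norm hp hw
  · rw [mul_assoc]
    exact dvd_mul_of_dvd_left h1 _
  · have e : s * π * ξ * conj (s * π) = s * (π * ξ * conj π) * conj s := by
      rw [conj_mul_rev]
      noncomm_ring
    rw [e]
    exact dvd_mul_of_dvd_left (natCast_dvd_mul_left (h π hπ) s) _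

/-- For pure isotropic `w = u i + v j + t k` and `ξ` with imaginary part `x`, the product `w ξ w̄`
is `2 ⟨w, x⟩ w` modulo `p`. The coordinates `b`, `c`, `d` are those of `2 x`. -/
theorem dvd_inner_mul {p : ℕ} (hp : p.Prime) (hp2 : p ≠ 2) {ξ : Hurwitz} {b c d u v t : ℤ}
    (hb : (ξ : Quaternion ℝ).imI = b / 2) (hc : (ξ : Quaternion ℝ).imJ = c / 2)
    (hd : (ξ : Quaternion ℝ).imK = d / 2) (hN : (p : ℤ) ∣ u ^ 2 + v ^ 2 + t ^ 2)
    (h : (p : Hurwitz) ∣ pure u v t * ξ * conj (pure u v t)) :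
    (p : ℤ) ∣ (u * b + v * c + t * d) * u ∧ (p : ℤ) ∣ (u * b + v * c + t * d) * v ∧
      (p : ℤ) ∣ (u * b + v * c + t * d) * t := by
  have hpI := Nat.prime_iff_prime_int.1 hp
  have h2 : ¬ (p : ℤ) ∣ 2 := fun h =>
    hp2 ((Nat.prime_dvd_prime_iff_eq hp Nat.prime_two).1 (by exact_mod_cast h))
  obtain ⟨m, hm⟩ := hN
  obtain ⟨⟨z, e, f, g, k, _, _, _, _, ef, eg, ek⟩, hz⟩ := h
  have hz' := congrArg (Subtype.val : Hurwitz → Quaternion ℝ) hz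
  have hm' : (u : ℝ) ^ 2 + v ^ 2 + t ^ 2 = p * m := by exact_mod_cast hm
  have eI := congrArg QuaternionAlgebra.imI hz'
  have eJ := congrArg QuaternionAlgebra.imJ hz'
  have eK := congrArg QuaternionAlgebra.imK hz'
  simp [coe_conj, hb, hc, hd, ef, eg, ek] at eI eJ eK
  refine ⟨(hpI.dvd_or_dvd (a := 2) ?_).resolve_left h2,
    (hpI.dvd_or_dvd (a := 2) ?_).resolve_left h2, (hpI.dvd_or_dvd (a := 2) ?_).resolve_left h2⟩
  · refine ⟨f + m * b, ?_⟩
    have : (2 * ((u * b + v * c + t * d) * u) : ℝ) = p * (f + m * b) := by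
      linear_combination 2 * eI + b * hm'
    exact_mod_cast this
  · refine ⟨g + m * c, ?_⟩
    have : (2 * ((u * b + v * c + t * d) * v) : ℝ) = p * (g + m * c) := by
      linear_combination 2 * eJ + c * hm'
    exact_mod_cast this
  · refine ⟨k + m * d, ?_⟩
    have : (2 * ((u * b + v * c + t * d) * t) : ℝ) = p * (k + m * d) := by
      linear_combination 2 * eK + d * hm'
    exact_mod_cast this

theorem exists_sq_add_sq_add_one {p : ℕ} (hp : p.Prime) :
    ∃ a b : ℤ, (p : ℤ) ∣ a ^ 2 + b ^ 2 + 1 := by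
  have := Fact.mk hp
  obtain ⟨a, b, h⟩ := ZMod.sq_add_sq p (-1)
  refine ⟨a.val, b.val, (ZMod.intCast_zmod_eq_zero_iff_dvd _ p).1 ?_⟩
  push_cast
  rw [ZMod.natCast_zmod_val, ZMod.natCast_zmod_val, h]
  ring

/-- If `π ξ π̄` is divisible by `p` for all `π` of norm `p`, that is, if every class is fixed by
`ξ`, then `ξ` is a scalar modulo `p`. -/
theorem exists_int_congMod {p : ℕ} (hp : p.Prime) (hp2 : p ≠ 2) {ξ : Hurwitz}
    (h : ∀ π : Hurwitz, norm π = p → (p : Hurwitz) ∣ π * ξ * conj π) :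
    ∃ n : ℤ, CongMod p ξ (n : Hurwitz) := by
  have hpI := Nat.prime_iff_prime_int.1 hp
  have h2 : ¬ (p : ℤ) ∣ 2 := fun h =>
    hp2 ((Nat.prime_dvd_prime_iff_eq hp Nat.prime_two).1 (by exact_mod_cast h))
  obtain ⟨x, y, hxy⟩ := exists_sq_add_sq_add_one hp
  obtain ⟨ξ, a, b, c, d, h1, h2', h3, ea, eb, ec, ed⟩ := ξ
  have key : ∀ {u v t : ℤ}, u ^ 2 + v ^ 2 + t ^ 2 = x ^ 2 + y ^ 2 + 1 →
      (p : ℤ) ∣ (u * b + v * c + t * d) * u ∧ (p : ℤ) ∣ (u * b + v * c + t * d) * v ∧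
      (p : ℤ) ∣ (u * b + v * c + t * d) * t := fun {u v t} e =>
    dvd_inner_mul hp hp2 eb ec ed (e ▸ hxy)
      (dvd_mul_mul_conj_of_dvd_norm hp h (by rw [norm_pure, e]; exact hxy))
  have hb : (p : ℤ) ∣ b := by
    refine (hpI.dvd_or_dvd (a := 2) ?_).resolve_left h2
    have k1 := (key (u := 1) (v := x) (t := y) (by ring)).1
    have k2 := (key (u := -1) (v := x) (t := y) (by ring)).1
    convert dvd_add k1 k2 using 1
    ring
  have hc : (p : ℤ) ∣ c := by
    refine (hpI.dvd_or_dvd (a := 2) ?_).resolve_left h2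
    have k1 := (key (u := x) (v := 1) (t := y) (by ring)).2.1
    have k2 := (key (u := x) (v := -1) (t := y) (by ring)).2.1
    convert dvd_add k1 k2 using 1
    ring
  have hd : (p : ℤ) ∣ d := by
    refine (hpI.dvd_or_dvd (a := 2) ?_).resolve_left h2
    have k1 := (key (u := x) (v := y) (t := 1) (by ring)).2.2
    have k2 := (key (u := x) (v := y) (t := -1) (by ring)).2.2
    convert dvd_add k1 k2 using 1
    ring
  obtain ⟨b, rfl⟩ := hb
  obtain ⟨c, rfl⟩ := hc
  obtain ⟨d, rfl⟩ := hd
  obtain ⟨m, hm⟩ := hp.odd_of_ne_two hp2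
  have hpm : (p : ℤ) = 2 * m + 1 := by exact_mod_cast hm
  -- As `p` is odd, `a ≡ b ≡ c ≡ d (mod 2)` for the quotients `b`, `c`, `d` too, so that
  -- `(a + b i + c j + d k) / 2` is in `𝓗`; it remains to solve `a = 2 n + p a`.
  have hodd : ∀ e : ℤ, (p : ℤ) * e ≡ e [ZMOD 2] := fun e =>
    Int.modEq_iff_dvd.2 ⟨-(m * e), by rw [hpm]; ring⟩
  obtain ⟨z, za, zb, zc, zd⟩ := exists_coordinates_eq (h1.trans (hodd b))
    (((hodd b).symm.trans h2').trans (hodd c)) (((hodd c).symm.trans h3).trans (hodd d))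
  refine ⟨-(m * a), z, ?_⟩
  have hpm' : (p : ℝ) = 2 * m + 1 := by exact_mod_cast hm
  apply Subtype.ext
  apply Quaternion.ext
  · simp [ea, za, hpm']
    ring
  · simp [eb, zb]
    ring
  · simp [ec, zc]
    ring
  · simp [ed, zd]
    ring

/-! ### The order of the metacommutation map -/

theorem mul_self_eq (x : Hurwitz) : x * x = (trace x : Hurwitz) * x - (norm x : Hurwitz) := by
  have h : x + conj x = (trace x : Hurwitz) := by
    apply Subtype.ext
    have h := trace_cast_eq x
    apply Quaternion.ext <;> simp [conj, h, two_mul]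
  have hc : conj x * x = x * conj x := by rw [conj_mul, mul_conj]
  rw [← h, ← conj_mul, add_mul, add_sub_cancel_right]

theorem metacommutation_pow_eq_one_iff {p q : ℕ} (hp : p.Prime) (hp2 : p ≠ 2) (hq : q.Prime)
    (hpq : p ≠ q) {ξ : Hurwitz} (hξ : IsPrimeAbove q ξ)
    (hξp : ¬ ∃ n : ℤ, CongMod p ξ (n : Hurwitz)) {n : ℕ} {a b : ℤ}
    (hn : ξ ^ n = (a : Hurwitz) * ξ + (b : Hurwitz)) :
    metacommutation hp hq hpq ξ hξ ^ n = 1 ↔ (p : ℤ) ∣ a := by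
  have e : ∀ π : Hurwitz, norm π = p →
      π * ξ ^ n * conj π = (a : Hurwitz) * (π * ξ * conj π) + p * (b : Hurwitz) := by
    intro π hπ
    rw [hn, mul_add, add_mul, ← (Int.cast_commute b π).eq, mul_assoc (b : Hurwitz), mul_conj, hπ,
      Int.cast_natCast, (Nat.cast_commute p (b : Hurwitz)).eq, ← mul_assoc π,
      ← (Int.cast_commute a π).eq]
    simp only [mul_assoc]
  constructor
  · intro h
    by_contra ha
    refine hξp (exists_int_congMod hp hp2 fun π hπ => natCast_dvd_of_intCast_mul hp ha ?_)
    have h1 := (metacommutation_pow_apply_eq_self_iff hp hq hpq hξ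
      ⟨irreducible_of_norm hp hπ, hπ⟩ n).1 (by rw [h, Equiv.Perm.one_apply])
    rw [e π hπ] at h1
    exact (dvd_add_left (dvd_mul_right _ _)).1 h1
  · intro ha
    ext c
    obtain ⟨⟨π, hπ⟩, rfl⟩ := Quotient.exists_rep c
    refine (metacommutation_pow_apply_eq_self_iff hp hq hpq hξ hπ n).2 ?_
    rw [e π hπ.2]
    exact dvd_add (dvd_mul_of_dvd_left (natCast_dvd_intCast ha) _) (dvd_mul_right _ _)

theorem isPureMod_iff_dvd_trace {p : ℕ} (x : Hurwitz) :
    IsPureMod p x ↔ (p : ℤ) ∣ trace x := by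
  constructor
  · rintro ⟨y, hy, z, hz⟩
    refine ⟨trace z, ?_⟩
    have h := congrArg (fun w : Hurwitz => (w : Quaternion ℝ).re) hz
    simp [hy] at h
    have h' : (trace x : ℝ) = p * trace z := by
      rw [trace_cast_eq, trace_cast_eq, h]
      ring
    exact_mod_cast h'
  · rintro ⟨m, hm⟩
    have hx := trace_cast_eq x
    rw [hm] at hx
    push_cast at hx
    -- Subtract `p` times `m (1 + i + j + k) / 2`, which has the right real part whatever the
    -- parity of `m`.
    obtain ⟨z, hz, -⟩ := exists_coordinates_eq (Int.ModEq.refl m) (Int.ModEq.refl m)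
      (Int.ModEq.refl m)
    refine ⟨x - p * z, ?_, z, by simp⟩
    simp [hz]
    linarith

end Hurwitz

theorem Equiv.Perm.forall_cycleType_eq_iff_pow_eq_one {α : Type*} [Fintype α] [DecidableEq α]
    (σ : Equiv.Perm α) {r : ℕ} (hr : r.Prime) : (∀ l ∈ σ.cycleType, l = r) ↔ σ ^ r = 1 := by
  rw [← orderOf_dvd_iff_pow_eq_one]
  constructor
  · intro h
    rw [← Equiv.Perm.lcm_cycleType, Multiset.lcm_dvd]
    exact fun l hl => (h l hl).dvd
  · intro h l hl
    have h1 := Equiv.Perm.two_le_of_mem_cycleType hl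
    exact ((Nat.dvd_prime hr).1 ((Equiv.Perm.dvd_of_mem_cycleType hl).trans h)).resolve_left
      (by omega)

theorem mainTheorem6 (p q : ℕ) (hp : p.Prime) (hp2 : p ≠ 2) (hq : q.Prime) (hpq : p ≠ q)
    (ξ : Hurwitz) (hξ : Hurwitz.IsPrimeAbove q ξ)
    (hξp : ¬ ∃ n : ℤ, Hurwitz.CongMod p ξ (n : Hurwitz)) :
    ((∀ l ∈ (Hurwitz.metacommutation hp hq hpq ξ hξ).cycleType, l = 2) ↔
        Hurwitz.IsPureMod p ξ) ∧
      ((∀ l ∈ (Hurwitz.metacommutation hp hq hpq ξ hξ).cycleType, l = 3) ↔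
        Hurwitz.norm ξ ≡ Hurwitz.trace ξ ^ 2 [ZMOD (p : ℤ)]) := by
  have e2 : ξ ^ 2 = (Hurwitz.trace ξ : Hurwitz) * ξ + ((-Hurwitz.norm ξ : ℤ) : Hurwitz) := by
    rw [pow_two, Hurwitz.mul_self_eq, Int.cast_neg, sub_eq_add_neg]
  have e3 : ξ ^ 3 = ((Hurwitz.trace ξ ^ 2 - Hurwitz.norm ξ : ℤ) : Hurwitz) * ξ +
      ((-(Hurwitz.trace ξ * Hurwitz.norm ξ) : ℤ) : Hurwitz) := by
    rw [pow_succ, e2, add_mul, mul_assoc, ← pow_two, e2]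
    push_cast
    noncomm_ring
  rw [Equiv.Perm.forall_cycleType_eq_iff_pow_eq_one _ Nat.prime_two,
    Equiv.Perm.forall_cycleType_eq_iff_pow_eq_one _ Nat.prime_three,
    Hurwitz.metacommutation_pow_eq_one_iff hp hp2 hq hpq hξ hξp e2,
    Hurwitz.metacommutation_pow_eq_one_iff hp hp2 hq hpq hξ hξp e3,
    Hurwitz.isPureMod_iff_dvd_trace, Int.modEq_iff_dvd]
  exact ⟨Iff.rfl, Iff.rfl⟩
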